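/- Let $M>0$, let $\mathbb{T}_M=\mathbb{R}/M\mathbb{Z}$, let $\mathcal{S}(\mathbb{T}_M)$ be the space of real-valued $M$-periodic $C^\infty$ functions, and let $\mathcal{M}(\mathbb{T}_M)$ be the space of $M$-periodic finite signed Radon measures, that is, of finite signed Borel measures on $\mathbb{T}_M$. For $w\in\mathcal{M}(\mathbb{T}_M)$ and $\varphi\in\mathcal{S}(\mathbb{T}_M)$ write $\langle w,\varphi\rangle=\int_{\mathbb{T}_M}\varphi\,\mathrm{d}w$. The RI-TV (TV-$\ell_2$) norm of $\mathbf{w}=(w_1,w_2)\in\mathcal{M}(\mathbb{T}_M)^2$ is $$\mathcal{R}(\mathbf{w})=\sup\Big\{\langle w_1,\varphi_1\rangle+\langle w_2,\varphi_2\rangle:\ \varphi_1,\varphi_2\in\mathcal{S}(\mathbb{T}_M),\ \sup_{t\in\mathbb{T}_M}\|(\varphi_1(t),\varphi_2(t))\|_2=1\Big\}.$$ Let $\mathrm{III}_M(\cdot-t_0)=\sum_{k\in\mathbb{Z}}\delta(\cdot-t_0-Mk)$ be the $M$-periodic Dirac comb shifted by $t_0$; as an element of $\mathcal{M}(\mathbb{T}_M)$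 it is the unit point mass at $t_0$. Then, for every $\mathbf{w}^*\in\mathcal{M}(\mathbb{T}_M)^2$, the following are equivalent: 1. $\mathbf{w}^*$ is an extreme point of the unit ball $\{\mathbf{w}\in\mathcal{M}(\mathbb{T}_M)^2:\mathcal{R}(\mathbf{w})\le 1\}$; 2. $\mathbf{w}^*$ is an extreme point of the unit sphere $\{\mathbf{w}\in\mathcal{M}(\mathbb{T}_M)^2:\mathcal{R}(\mathbf{w})=1\}$; 3. $\mathbf{w}^*=\mathbf{a}\,\mathrm{III}_M(\cdot-t_0)$ for some $t_0\in\mathbb{T}_M$ and some $\mathbf{a}\in\mathbb{R}^2$ with $\|\mathbf{a}\|_2=1$. Here an extreme point of a set $B$ (convex or not) is a point of $B$ that does not lie strictly between two distinct points of $B$. -/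

import Mathlib

open MeasureTheory
open scoped ContDiff ENNReal

noncomputable section

namespace RITV

/-- The space `𝒮(𝕋_M)` of real `M`-periodic smooth functions, seen as functions on the circle
`𝕋_M = ℝ / Mℤ`: those `φ` for which the `M`-periodic function `t ↦ φ (t mod M)` on the real line
is infinitely differentiable. -/
def TestSpace (M : ℝ) : Set (AddCircle M → ℝ) :=
  {φ | ContDiff ℝ ∞ (fun t : ℝ => φ (t : AddCircle M))}

/-- The space `ℳ(𝕋_M)` of `M`-periodic finite (signed, real) Radon measures: finite signed Borel
measures on the circle `𝕋_M`. As the circle is compact and metrizable, all of them are Radon. -/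
abbrev RadonMeasure (M : ℝ) : Type := SignedMeasure (AddCircle M)

/-- The duality product `⟨w, φ⟩ = ∫ φ dw` of a signed measure and a function. -/
def pairing {M : ℝ} (w : RadonMeasure M) (φ : AddCircle M → ℝ) : ℝ :=
  w.integral φ (ContinuousLinearMap.lsmul ℝ ℝ)

/-- The mixed norm `‖φ‖_{2,∞} = sup_t ‖(φ₁(t), φ₂(t))‖₂`, where `‖·‖₂` is the Euclidean norm. -/
def mixedNorm {M : ℝ} (φ : Fin 2 → AddCircle M → ℝ) : ℝ≥0∞ :=
  ⨆ t : AddCircle M, ‖(WithLp.toLp 2 (fun i => φ i t) : EuclideanSpace ℝ (Fin 2))‖ₑ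

/-- The rotation-invariant total-variation (TV-ℓ₂) norm of a vector-valued measure,
`ℛ(w) = sup {⟨w₁, φ₁⟩ + ⟨w₂, φ₂⟩ : φ₁, φ₂ ∈ 𝒮(𝕋_M), ‖(φ₁, φ₂)‖_{2,∞} = 1}`,
the supremum being taken in the extended reals. -/
def riTV {M : ℝ} (w : Fin 2 → RadonMeasure M) : EReal :=
  ⨆ φ ∈ {φ : Fin 2 → AddCircle M → ℝ | (∀ i, φ i ∈ TestSpace M) ∧ mixedNorm φ = 1},
    ((pairing (w 0) (φ 0) + pairing (w 1) (φ 1) : ℝ) : EReal)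

/-- The unit ball of the RI-TV norm in `ℳ(𝕋_M)²`. -/
def unitBall (M : ℝ) : Set (Fin 2 → RadonMeasure M) := {w | riTV w ≤ 1}

/-- The unit sphere of the RI-TV norm in `ℳ(𝕋_M)²`. -/
def unitSphere (M : ℝ) : Set (Fin 2 → RadonMeasure M) := {w | riTV w = 1}

/-- The shifted `M`-periodic Dirac comb `Ш_M(· - t₀) = ∑_{k ∈ ℤ} δ(· - t₀ - M k)`. All the points
`t₀ + M k` are one and the same point of the circle `𝕋_M = ℝ / Mℤ`, and every period contains
exactly one of them, so as an element of `ℳ(𝕋_M)` the comb is the unit mass at the point `t₀`. -/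
def diracComb (M : ℝ) (t₀ : AddCircle M) : RadonMeasure M := VectorMeasure.dirac t₀ 1

/-- The vector-valued Dirac comb `a Ш_M(· - t₀) = (a₁ Ш_M(· - t₀), a₂ Ш_M(· - t₀))`. -/
def vectorDiracComb (M : ℝ) (a : EuclideanSpace ℝ (Fin 2)) (t₀ : AddCircle M) :
    Fin 2 → RadonMeasure M := fun i => a i • diracComb M t₀

end RITV

end

/-!
Identify `w ∈ ℳ(𝕋_M)²` with one `ℝ²`-valued measure `W`. Partitions that almost realize the total
variation `|W|(𝕋_M)` give measurable fields in the unit ball which almost maximize the duality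
product; replacing them by smooth fields shows that `ℛ(w) = |W|(𝕋_M)`. If `W` is extreme in the
unit ball or sphere of the total variation, then `|W|` takes only the values `0` and `1`, because
otherwise `W` lies strictly between its normalized restrictions to a set and to its complement;
hence `W` is a point mass. Conversely, if `a δ_t` with `‖a‖ = 1` lies strictly between `U` and `V`
in the unit ball, strict convexity of the Euclidean norm gives `U {t} = V {t} = a`, which leaves no
mass for `U` and `V` away from `t`.
-/

noncomputable section

namespace RITV

open Set

section TotalVariationBall

variable {X E : Type*} [MeasurableSpace X] [NormedAddCommGroup E]

variable (X E) in
/-- The unit ball of the total variation norm `|W|(X)` on the `E`-valued measures on `X`;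
measures of infinite variation, which `VectorMeasure` allows, are thereby excluded. -/
def tvBall : Set (VectorMeasure X E) := {W | W.variation univ ≤ 1}

variable (X E) in
/-- The unit sphere of the total variation norm `|W|(X)` on the `E`-valued measures on `X`. -/
def tvSphere : Set (VectorMeasure X E) := {W | W.variation univ = 1}

theorem tvSphere_subset_tvBall : tvSphere X E ⊆ tvBall X E := fun _ hW => le_of_eq hW

theorem norm_apply_le_one_of_mem_tvBall {W : VectorMeasure X E} (hW : W ∈ tvBall X E)
    (A : Set X) : ‖W A‖ ≤ 1 := by
  have : ‖W A‖ₑ ≤ 1 :=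
    (W.enorm_measure_le_variation A).trans <| (measure_mono (subset_univ A)).trans hW
  rwa [← ofReal_norm, ENNReal.ofReal_le_one] at this

theorem dirac_mem_tvSphere (t : X) {a : E} (ha : ‖a‖ = 1) :
    VectorMeasure.dirac t a ∈ tvSphere X E := by
  simp [tvSphere, ← ofReal_norm, ha]

theorem eq_dirac_of_variation_compl_eq_zero [MeasurableSingletonClass X] {W : VectorMeasure X E}
    {t : X} (hW : W.variation {t}ᶜ = 0) : W = VectorMeasure.dirac t (W {t}) := by
  have ht : MeasurableSet {t} := measurableSet_singleton t
  have hrestrict : W.restrict {t}ᶜ = 0 := by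
    rwa [← VectorMeasure.variation_eq_zero, VectorMeasure.variation_restrict ht.compl,
      Measure.restrict_eq_zero]
  rw [← VectorMeasure.restrict_singleton, ← add_zero (W.restrict {t}), ← hrestrict,
    VectorMeasure.restrict_add_restrict_compl ht]

theorem eq_dirac_of_mem_tvBall [MeasurableSingletonClass X] {W : VectorMeasure X E} {t : X}
    (hW : W ∈ tvBall X E) (ht : ‖W {t}‖ = 1) : W = VectorMeasure.dirac t (W {t}) := by
  apply eq_dirac_of_variation_compl_eq_zero
  have hatom : 1 ≤ W.variation {t} := by
    simpa [← ofReal_norm, ht] using W.enorm_measure_le_variation {t}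
  have hsum : W.variation {t} + W.variation {t}ᶜ ≤ 1 :=
    (measure_add_measure_compl (measurableSet_singleton t)).trans_le hW
  have hle : 1 + W.variation {t}ᶜ ≤ 1 + 0 := by
    simpa using (add_le_add_left hatom _).trans hsum
  exact nonpos_iff_eq_zero.1 ((ENNReal.add_le_add_iff_left ENNReal.one_ne_top).1 hle)

variable [NormedSpace ℝ E]

theorem dirac_mem_extremePoints_tvBall [MeasurableSingletonClass X] [StrictConvexSpace ℝ E]
    (t : X) {a : E} (ha : ‖a‖ = 1) :
    VectorMeasure.dirac t a ∈ (tvBall X E).extremePoints ℝ := by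
  refine ⟨tvSphere_subset_tvBall (dirac_mem_tvSphere t ha), fun U hU V hV hseg => ?_⟩
  obtain ⟨r, s, hr, hs, hrs, hUV⟩ := hseg
  have ha_seg : a ∈ openSegment ℝ (U {t}) (V {t}) :=
    ⟨r, s, hr, hs, hrs, by simpa using DFunLike.congr_fun hUV {t}⟩
  have ha_extreme : a ∈ (Metric.closedBall (0 : E) 1).extremePoints ℝ :=
    StrictConvexSpace.sphere_subset_extremePoints_closedBall 0 one_ne_zero (by simpa using ha)
  have hUa : U {t} = a := ha_extreme.2
    (by simpa using norm_apply_le_one_of_mem_tvBall hU {t})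
    (by simpa using norm_apply_le_one_of_mem_tvBall hV {t}) ha_seg
  rw [eq_dirac_of_mem_tvBall hU (by rw [hUa, ha]), hUa]

theorem inv_smul_restrict_mem_tvSphere {W : VectorMeasure X E} {A : Set X}
    (hA : MeasurableSet A) (hpos : 0 < W.variation.real A) :
    (W.variation.real A)⁻¹ • W.restrict A ∈ tvSphere X E := by
  obtain ⟨h0, htop⟩ := ENNReal.toReal_pos_iff.1 hpos
  have hnorm : ‖(W.variation.real A)⁻¹‖ₑ = (W.variation A)⁻¹ := by
    rw [Real.enorm_of_nonneg (by positivity), ENNReal.ofReal_inv_of_pos hpos,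
      ofReal_measureReal htop.ne]
  change ((W.variation.real A)⁻¹ • W.restrict A).variation univ = 1
  rw [VectorMeasure.variation_smul, VectorMeasure.variation_restrict hA,
    Measure.smul_apply, ENNReal.smul_def, smul_eq_mul, Measure.restrict_apply_univ,
    ← enorm_eq_nnnorm, hnorm, ENNReal.inv_mul_cancel h0.ne' htop.ne]

/-- If `0 < |W|(A) < 1`, then `W` lies strictly between its normalized restrictions to `A` and
`Aᶜ`. -/
theorem isZeroOneMeasure_variation_of_mem_extremePoints_tvSphere {W : VectorMeasure X E}
    (hW : W ∈ (tvSphere X E).extremePoints ℝ) : IsZeroOneMeasure W.variation := by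
  have : IsProbabilityMeasure W.variation := ⟨hW.1⟩
  refine ⟨fun A hA => or_iff_not_imp_left.2 fun hA0 => ?_⟩
  rw [← prob_compl_eq_zero_iff hA]
  by_contra hAc0
  have hsum : W.variation.real A + W.variation.real Aᶜ = 1 := probReal_add_probReal_compl hA
  have hpos : 0 < W.variation.real A :=
    ENNReal.toReal_pos hA0 (measure_ne_top _ _)
  have hposc : 0 < W.variation.real Aᶜ :=
    ENNReal.toReal_pos hAc0 (measure_ne_top _ _)
  have heq : (W.variation.real A)⁻¹ • W.restrict A = W := hW.2
    (inv_smul_restrict_mem_tvSphere hA hpos) (inv_smul_restrict_mem_tvSphere hA.compl hposc)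
    ⟨_, _, hpos, hposc, hsum, by
      rw [smul_inv_smul₀ hpos.ne', smul_inv_smul₀ hposc.ne',
        VectorMeasure.restrict_add_restrict_compl hA]⟩
  apply hAc0
  rw [← heq, VectorMeasure.variation_smul, VectorMeasure.variation_restrict hA]
  simp [hA.compl]

theorem exists_eq_dirac_of_mem_extremePoints_tvSphere [StandardBorelSpace X]
    {W : VectorMeasure X E} (hW : W ∈ (tvSphere X E).extremePoints ℝ) :
    ∃ (t : X) (a : E), ‖a‖ = 1 ∧ W = VectorMeasure.dirac t a := by
  have := isZeroOneMeasure_variation_of_mem_extremePoints_tvSphere hW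
  have hmass : W.variation univ = 1 := hW.1
  have : NeZero W.variation := ⟨fun h => by simp [h] at hmass⟩
  obtain ⟨t, ht⟩ := IsZeroOneMeasure.exists_eq_dirac (μ := W.variation)
  have hWt : W = VectorMeasure.dirac t (W {t}) :=
    eq_dirac_of_variation_compl_eq_zero (by simp [ht])
  refine ⟨t, W {t}, ?_, hWt⟩
  rw [hWt, VectorMeasure.variation_dirac] at hmass
  simpa [← ofReal_norm] using hmass

theorem extremePoints_tvBall_subset_tvSphere [Nonempty X] [Nontrivial E] :
    (tvBall X E).extremePoints ℝ ⊆ tvSphere X E := by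
  intro W hW
  by_contra hne
  have hlt : W.variation univ < 1 := lt_of_le_of_ne hW.1 hne
  have : IsFiniteMeasure W.variation := ⟨hlt.trans ENNReal.one_lt_top⟩
  have hreal : W.variation.real univ < 1 :=
    ENNReal.toReal_lt_of_lt_ofReal (by simpa using hlt)
  obtain ⟨t⟩ := ‹Nonempty X›
  obtain ⟨a, ha⟩ := exists_norm_eq E (sub_pos.2 hreal).le
  have hadd : W.variation univ + (VectorMeasure.dirac t a).variation univ ≤ 1 := by
    rw [VectorMeasure.variation_dirac, Measure.smul_apply, Measure.dirac_apply_of_mem (mem_univ t),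
      smul_eq_mul, mul_one, ← ofReal_norm, ha, ← ofReal_measureReal,
      ← ENNReal.ofReal_add measureReal_nonneg (sub_pos.2 hreal).le, add_sub_cancel,
      ENNReal.ofReal_one]
  have hfix : W + VectorMeasure.dirac t a = W := hW.2
    ((VectorMeasure.variation_add_le univ).trans hadd)
    ((VectorMeasure.variation_sub_le univ).trans hadd)
    ⟨1 / 2, 1 / 2, by norm_num, by norm_num, by norm_num, by module⟩
  have ha0 : a = 0 := by simpa using DFunLike.congr_fun hfix univ
  rw [ha0, norm_zero] at ha
  exact (sub_pos.2 hreal).ne ha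

theorem mem_extremePoints_tvBall_iff [StandardBorelSpace X] [Nonempty X] [Nontrivial E]
    [StrictConvexSpace ℝ E] {W : VectorMeasure X E} :
    W ∈ (tvBall X E).extremePoints ℝ ↔
      ∃ (t : X) (a : E), ‖a‖ = 1 ∧ W = VectorMeasure.dirac t a := by
  constructor
  · intro hW
    exact exists_eq_dirac_of_mem_extremePoints_tvSphere <|
      inter_extremePoints_subset_extremePoints_of_subset tvSphere_subset_tvBall
        ⟨extremePoints_tvBall_subset_tvSphere hW, hW⟩
  · rintro ⟨t, a, ha, rfl⟩
    exact dirac_mem_extremePoints_tvBall t ha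

theorem mem_extremePoints_tvSphere_iff [StandardBorelSpace X] [StrictConvexSpace ℝ E]
    {W : VectorMeasure X E} :
    W ∈ (tvSphere X E).extremePoints ℝ ↔
      ∃ (t : X) (a : E), ‖a‖ = 1 ∧ W = VectorMeasure.dirac t a := by
  constructor
  · exact exists_eq_dirac_of_mem_extremePoints_tvSphere
  · rintro ⟨t, a, ha, rfl⟩
    exact inter_extremePoints_subset_extremePoints_of_subset tvSphere_subset_tvBall
      ⟨dirac_mem_tvSphere t ha, dirac_mem_extremePoints_tvBall t ha⟩

end TotalVariationBall

section Integral

variable {X E F F' G : Type*} [MeasurableSpace X] [NormedAddCommGroup E] [NormedSpace ℝ E]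
  [NormedAddCommGroup F] [NormedSpace ℝ F] [NormedAddCommGroup F'] [NormedSpace ℝ F']
  [NormedAddCommGroup G] [NormedSpace ℝ G]

theorem variation_mapRange_le (W : VectorMeasure X F) (L : F →L[ℝ] F') :
    (W.mapRange L.toAddMonoidHom L.continuous).variation ≤ ‖L‖₊ • W.variation := by
  refine VectorMeasure.variation_le_of_forall_enorm_le fun A _ => ?_
  calc ‖L (W A)‖ₑ ≤ ‖L‖ₑ * ‖W A‖ₑ := L.le_opENorm _
    _ ≤ ‖L‖ₑ * W.variation A := by gcongr; exact W.enorm_measure_le_variation A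

/-- `(B.flip ∘L L).flip` is the pairing `x, y ↦ B x (L y)`. -/
theorem integral_mapRange {W : VectorMeasure X F} {f : X → E} (hf : W.Integrable f)
    (L : F →L[ℝ] F') (B : E →L[ℝ] F' →L[ℝ] G) :
    (W.mapRange L.toAddMonoidHom L.continuous).integral f B
      = W.integral f (B.flip ∘L L).flip := by
  have hfL : (W.mapRange L.toAddMonoidHom L.continuous).Integrable f :=
    (Integrable.smul_measure_nnreal hf).mono_measure (variation_mapRange_le W L)
  have htranspose : (W.mapRange L.toAddMonoidHom L.continuous).transpose B
      = W.transpose (B.flip ∘L L).flip := by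
    ext; rfl
  rw [VectorMeasure.integral_eq_setToFun_transpose hfL,
    VectorMeasure.integral_eq_setToFun_transpose hf]
  simp only [htranspose]

end Integral

section EuclideanMeasure

variable {X ι : Type*} [MeasurableSpace X] [Fintype ι]

/-- The linear identification of families of signed measures `w i` with the measures valued in
`EuclideanSpace ℝ ι` that have them as coordinates. The Euclidean norm on the values makes the total
variation of `euclideanMeasure w` the rotation-invariant one. -/
def euclideanMeasure : (ι → SignedMeasure X) ≃ₗ[ℝ] VectorMeasure X (EuclideanSpace ℝ ι) where
  toFun w :=
    { measureOf' := fun A => WithLp.toLp 2 fun i => w i A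
      empty' := by ext; simp
      not_measurable' := fun A hA => by ext i; simp [(w i).not_measurable hA]
      m_iUnion' := fun A hA hd =>
        (EuclideanSpace.equiv ι ℝ).symm.toContinuousLinearMap.hasSum
          (Pi.hasSum.2 fun i => (w i).m_iUnion hA hd) }
  map_add' u w := by ext; rfl
  map_smul' c w := by ext; rfl
  invFun W i := W.mapRange (EuclideanSpace.proj i : EuclideanSpace ℝ ι →L[ℝ] ℝ).toAddMonoidHom
    (EuclideanSpace.proj i : EuclideanSpace ℝ ι →L[ℝ] ℝ).continuous
  left_inv w := by ext; rfl
  right_inv W := by ext; rfl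

theorem euclideanMeasure_apply (w : ι → SignedMeasure X) (A : Set X) (i : ι) :
    euclideanMeasure w A i = w i A := rfl

theorem variation_euclideanMeasure_le (w : ι → SignedMeasure X) :
    (euclideanMeasure w).variation ≤ ∑ i, (w i).variation := by
  classical
  refine VectorMeasure.variation_le_of_forall_enorm_le fun A _ => ?_
  have hsum : euclideanMeasure w A = ∑ i, EuclideanSpace.single i (w i A) := by
    ext j; simp [euclideanMeasure_apply]
  rw [hsum, Measure.finsetSum_apply]
  calc ‖∑ i, EuclideanSpace.single i (w i A)‖ₑ ≤ ∑ i, ‖w i A‖ₑ := by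
        simpa [enorm_eq_nnnorm] using
          enorm_sum_le Finset.univ fun i => EuclideanSpace.single i (w i A)
    _ ≤ ∑ i, (w i).variation A :=
        Finset.sum_le_sum fun i _ => (w i).enorm_measure_le_variation A

instance isFiniteMeasure_variation_euclideanMeasure (w : ι → SignedMeasure X) :
    IsFiniteMeasure (euclideanMeasure w).variation := by
  have hfin : ∀ i, IsFiniteMeasure (w i).variation := fun i => by
    rw [← SignedMeasure.totalVariation_eq_variation, SignedMeasure.totalVariation]
    infer_instance
  exact isFiniteMeasure_of_le _ (variation_euclideanMeasure_le w)

theorem sum_integral_eq_integral_inner {w : ι → SignedMeasure X} {f : X → EuclideanSpace ℝ ι}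
    (hf : (euclideanMeasure w).Integrable f) :
    ∑ i, (w i).integral (fun x => f x i) (ContinuousLinearMap.lsmul ℝ ℝ)
      = (euclideanMeasure w).integral f (innerSL ℝ) := by
  let p (i : ι) : EuclideanSpace ℝ ι →L[ℝ] ℝ := EuclideanSpace.proj i
  let B (i : ι) : ℝ →L[ℝ] EuclideanSpace ℝ ι →L[ℝ] ℝ :=
    ((ContinuousLinearMap.lsmul ℝ ℝ).flip ∘L p i).flip
  have hcoord (i : ι) : (w i).integral (fun x => f x i) (ContinuousLinearMap.lsmul ℝ ℝ)
      = (euclideanMeasure w).integral f (B i ∘L p i) :=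
    calc (w i).integral (fun x => f x i) (ContinuousLinearMap.lsmul ℝ ℝ)
        = (euclideanMeasure w).integral (fun x => p i (f x)) (B i) :=
          integral_mapRange ((p i).integrable_comp hf) (p i) _
      _ = (euclideanMeasure w).integral f (B i ∘L p i) :=
          VectorMeasure.integral_continuousLinearMap_comp hf
  have hinner : ∑ i, B i ∘L p i = innerSL ℝ := by
    ext x y
    change (∑ i, B i ∘L p i) x y = inner ℝ x y
    simp [B, p, PiLp.inner_apply, mul_comm]
  simp only [hcoord]
  rw [← VectorMeasure.integral_finsetSum_cbm hf, hinner]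

end EuclideanMeasure

theorem norm_sum_indicator_const_le {X E : Type*} [SeminormedAddCommGroup E]
    {P : Finset (Set X)} {e : Set X → E}
    (hP : (P : Set (Set X)).PairwiseDisjoint id) {C : ℝ} (hC : 0 ≤ C) (he : ∀ p ∈ P, ‖e p‖ ≤ C)
    (x : X) :
    ‖∑ p ∈ P, p.indicator (fun _ => e p) x‖ ≤ C := by
  by_cases hx : ∃ p ∈ P, x ∈ p
  · obtain ⟨p, hpP, hxp⟩ := hx
    have hother : ∀ q ∈ P, q ≠ p → q.indicator (fun _ => e q) x = 0 := fun q hq hqp =>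
      indicator_of_notMem (fun hxq => (hP hq hpP hqp).le_bot ⟨hxq, hxp⟩) _
    rw [Finset.sum_eq_single_of_mem p hpP hother, indicator_of_mem hxp]
    exact he p hpP
  · push Not at hx
    rwa [Finset.sum_eq_zero fun p hp => indicator_of_notMem (hx p hp) _, norm_zero]

section Duality

variable {X E : Type*} [MeasurableSpace X] [NormedAddCommGroup E] [InnerProductSpace ℝ E]

theorem norm_integral_inner_le {W : VectorMeasure X E} {f : X → E} :
    ‖W.integral f (innerSL ℝ)‖ ≤ ∫ x, ‖f x‖ ∂W.variation :=
  VectorMeasure.norm_integral_le_integral_norm.trans <|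
    mul_le_of_le_one_left (integral_nonneg fun _ => norm_nonneg _) (norm_innerSL_le ℝ)

theorem norm_integral_inner_le_of_norm_le {W : VectorMeasure X E} [IsFiniteMeasure W.variation]
    {f : X → E} {C : ℝ} (hf : ∀ x, ‖f x‖ ≤ C) :
    ‖W.integral f (innerSL ℝ)‖ ≤ W.variation.real univ * C :=
  calc ‖W.integral f (innerSL ℝ)‖ ≤ ∫ x, ‖f x‖ ∂W.variation := norm_integral_inner_le
    _ ≤ ∫ _, C ∂W.variation :=
        integral_mono_of_nonneg (.of_forall fun _ => norm_nonneg _) (integrable_const _)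
          (.of_forall hf)
    _ = W.variation.real univ * C := by simp

theorem exists_norm_le_one_sub_le_integral_inner (W : VectorMeasure X E)
    [IsFiniteMeasure W.variation] {ε : ℝ} (hε : 0 < ε) :
    ∃ h : X → E, W.Integrable h ∧ (∀ x, ‖h x‖ ≤ 1) ∧
      W.variation.real univ - ε ≤ W.integral h (innerSL ℝ) := by
  obtain ⟨P, -, hdisj, hmeas, hP⟩ := W.exists_variation_le_add MeasurableSet.univ
    (Real.toNNReal_pos.2 hε) (measure_ne_top _ _)
  -- On each piece of a nearly optimal partition, test `W` against its own direction there.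
  let h (p : Set X) : X → E := p.indicator fun _ => ‖W p‖⁻¹ • W p
  have h_int : ∀ p ∈ P, W.Integrable (h p) := fun p hp =>
    (integrable_const _).indicator (hmeas p hp)
  have hval : ∀ p ∈ P, W.integral (h p) (innerSL ℝ) = ‖W p‖ := fun p hp => by
    rw [VectorMeasure.integral_indicator_const _ (hmeas p hp)]
    change inner ℝ (‖W p‖⁻¹ • W p) (W p) = ‖W p‖
    rw [real_inner_smul_left, real_inner_self_eq_norm_mul_norm, ← mul_assoc]
    exact inv_mul_mul_self _
  refine ⟨fun x => ∑ p ∈ P, h p x, integrable_finsetSum P h_int,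
    norm_sum_indicator_const_le hdisj zero_le_one fun p _ => ?_, ?_⟩
  · rw [norm_smul, norm_inv, norm_norm]
    exact inv_mul_le_one
  · rw [VectorMeasure.integral_finsetSum P h_int, Finset.sum_congr rfl hval, sub_le_iff_le_add]
    have hP' : W.variation.real univ ≤ (∑ p ∈ P, ‖W p‖ₑ + ENNReal.ofReal ε).toReal :=
      ENNReal.toReal_mono (by simp) hP
    rwa [ENNReal.toReal_add (by simp) (by simp), ENNReal.toReal_sum (by simp),
      ENNReal.toReal_ofReal hε.le] at hP'

end Duality

section Approximation

variable {E : Type*} [NormedAddCommGroup E] [NormedSpace ℝ E]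

theorem norm_radial_sub_le {u v : E} (hv : ‖v‖ ≤ 1) :
    ‖(max 1 ‖u‖)⁻¹ • u - v‖ ≤ 2 * ‖u - v‖ := by
  have hmove : ‖(max 1 ‖u‖)⁻¹ • u - u‖ ≤ ‖u - v‖ := by
    rcases le_total ‖u‖ 1 with hu | hu
    · simp [max_eq_left hu]
    · calc ‖(max 1 ‖u‖)⁻¹ • u - u‖ = ‖(‖u‖⁻¹ - 1) • u‖ := by
            rw [max_eq_right hu, sub_smul, one_smul]
        _ = ‖u‖ - 1 := by
            rw [norm_smul, Real.norm_of_nonpos (sub_nonpos.2 (inv_le_one_of_one_le₀ hu)), neg_sub,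
              sub_mul, one_mul, inv_mul_cancel₀ (one_pos.trans_le hu).ne']
        _ ≤ ‖u‖ - ‖v‖ := by gcongr
        _ ≤ ‖u - v‖ := norm_sub_norm_le u v
  calc ‖(max 1 ‖u‖)⁻¹ • u - v‖ ≤ ‖(max 1 ‖u‖)⁻¹ • u - u‖ + ‖u - v‖ :=
        norm_sub_le_norm_sub_add_norm_sub _ _ _
    _ ≤ 2 * ‖u - v‖ := by rw [two_mul]; gcongr

theorem exists_continuous_norm_le_one_integral_norm_sub_le {X : Type*} [TopologicalSpace X]
    [NormalSpace X] [MeasurableSpace X] [BorelSpace X] {ν : Measure X} [ν.WeaklyRegular]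
    {h : X → E} (h_int : Integrable h ν) (hh : ∀ x, ‖h x‖ ≤ 1) {ε : ℝ} (hε : 0 < ε) :
    ∃ f : X → E, Continuous f ∧ (∀ x, ‖f x‖ ≤ 1) ∧ ∫ x, ‖f x - h x‖ ∂ν ≤ ε := by
  obtain ⟨g, hg, hgint⟩ := h_int.exists_boundedContinuous_integral_sub_le (half_pos hε)
  have hpos : ∀ x, 0 < max 1 ‖g x‖ := fun x => lt_max_of_lt_left one_pos
  refine ⟨fun x => (max 1 ‖g x‖)⁻¹ • g x, ?_, fun x => ?_, ?_⟩
  · exact ((continuous_const.max g.continuous.norm).inv₀ fun x => (hpos x).ne').smul g.continuous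
  · rw [norm_smul, norm_inv, Real.norm_of_nonneg (hpos x).le]
    exact inv_mul_le_one_of_le₀ (le_max_right _ _) (hpos x).le
  · calc ∫ x, ‖(max 1 ‖g x‖)⁻¹ • g x - h x‖ ∂ν ≤ ∫ x, 2 * ‖g x - h x‖ ∂ν :=
          integral_mono_of_nonneg (.of_forall fun x => norm_nonneg _)
            ((hgint.sub h_int).norm.const_mul 2) (.of_forall fun x => norm_radial_sub_le (hh x))
      _ = 2 * ∫ x, ‖h x - g x‖ ∂ν := by
          simp only [norm_sub_rev (g _), integral_const_mul]
      _ ≤ ε := by linarith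

theorem exists_contDiff_norm_le_norm_sub_le {M : ℝ} [Fact (0 < M)] [CompleteSpace E]
    {f : AddCircle M → E} (hf : Continuous f) {C : ℝ} (hC : ∀ t, ‖f t‖ ≤ C) {ε : ℝ} (hε : 0 < ε) :
    ∃ g : AddCircle M → E, ContDiff ℝ ∞ (fun t : ℝ => g t) ∧ (∀ t, ‖g t‖ ≤ C) ∧
      ∀ t, ‖g t - f t‖ ≤ ε := by
  let F : ℝ → E := fun t => f t
  have hF : Continuous F := hf.comp (AddCircle.continuous_mk' M)
  have hFu : UniformContinuous F :=
    (CompactSpace.uniformContinuous_of_continuous hf).comp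
      (uniformContinuous_addMonoidHom_of_continuous (f := QuotientAddGroup.mk' _)
        (AddCircle.continuous_mk' M))
  obtain ⟨δ, hδ, hFδ⟩ := Metric.uniformContinuous_iff.1 hFu ε hε
  let φ : ContDiffBump (0 : ℝ) := ⟨δ / 2, δ, half_pos hδ, half_lt_self hδ⟩
  let G : ℝ → E := convolution (φ.normed volume) F (ContinuousLinearMap.lsmul ℝ ℝ) volume
  have hG : ContDiff ℝ ∞ G :=
    φ.hasCompactSupport_normed.contDiff_convolution_left _ φ.contDiff_normed hF.locallyIntegrable
  have hGper : Function.Periodic G M := fun x => by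
    simp only [G, convolution_def, F]
    simp [add_sub_right_comm]
  have hGC : ∀ x, ‖G x‖ ≤ C := fun x => by
    rw [← dist_zero_right]
    exact dist_convolution_le ((norm_nonneg _).trans (hC 0)) φ.support_normed_eq.subset
      φ.nonneg_normed φ.integral_normed hF.aestronglyMeasurable fun y _ => by
        rw [dist_zero_right]; exact hC y
  have hGF : ∀ x, ‖G x - F x‖ ≤ ε := fun x => by
    rw [← dist_eq_norm]
    exact φ.dist_normed_convolution_le hF.aestronglyMeasurable fun y hy => (hFδ hy).le
  refine ⟨hGper.lift, hG, fun t => ?_, fun t => ?_⟩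
  · induction t using QuotientAddGroup.induction_on with | H x => exact hGC x
  · induction t using QuotientAddGroup.induction_on with | H x => exact hGF x

end Approximation

theorem mem_extremePoints_preimage_iff {𝕜 V V' : Type*} [Ring 𝕜] [PartialOrder 𝕜]
    [IsOrderedRing 𝕜] [AddCommGroup V] [Module 𝕜 V] [AddCommGroup V'] [Module 𝕜 V']
    (e : V ≃ₗ[𝕜] V') {s : Set V'} {v : V} :
    v ∈ (e ⁻¹' s).extremePoints 𝕜 ↔ e v ∈ s.extremePoints 𝕜 := by
  rw [← e.image_symm_eq_preimage, ← image_extremePoints, e.image_symm_eq_preimage, mem_preimage]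

section RotationInvariantTV

variable {M : ℝ}

theorem continuous_of_continuous_coe {Y : Type*} [TopologicalSpace Y] {f : AddCircle M → Y}
    (hf : Continuous fun t : ℝ => f t) : Continuous f :=
  (isQuotientMap_quotient_mk' (s := QuotientAddGroup.leftRel _)).continuous_iff.2 hf

theorem integrable_of_continuous_coe [Fact (0 < M)] {E : Type*} [NormedAddCommGroup E]
    {Φ : AddCircle M → E} (hΦ : Continuous fun t : ℝ => Φ t) (ν : Measure (AddCircle M))
    [IsFiniteMeasure ν] : Integrable Φ ν :=
  (continuous_of_continuous_coe hΦ).integrable_of_hasCompactSupport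
    (HasCompactSupport.of_compactSpace Φ)

theorem exists_contDiff_norm_le_one_integral_norm_sub_le [Fact (0 < M)] {E : Type*}
    [NormedAddCommGroup E] [NormedSpace ℝ E] [CompleteSpace E] {ν : Measure (AddCircle M)}
    [IsFiniteMeasure ν] {h : AddCircle M → E} (h_int : Integrable h ν) (hh : ∀ t, ‖h t‖ ≤ 1)
    {ε : ℝ} (hε : 0 < ε) :
    ∃ Φ : AddCircle M → E, ContDiff ℝ ∞ (fun t : ℝ => Φ t) ∧ (∀ t, ‖Φ t‖ ≤ 1) ∧
      ∫ t, ‖Φ t - h t‖ ∂ν ≤ ε := by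
  obtain ⟨f, hf, hf1, hfh⟩ :=
    exists_continuous_norm_le_one_integral_norm_sub_le h_int hh (half_pos hε)
  have hfint : Integrable f ν := .of_bound hf.aestronglyMeasurable 1 (.of_forall hf1)
  have hmass : 0 < 1 + ν.real univ := by positivity
  obtain ⟨Φ, hΦ, hΦ1, hΦf⟩ :=
    exists_contDiff_norm_le_norm_sub_le hf hf1 (div_pos (half_pos hε) hmass)
  have hΦint : Integrable Φ ν := integrable_of_continuous_coe hΦ.continuous ν
  refine ⟨Φ, hΦ, hΦ1, ?_⟩
  have hfhint : Integrable (fun t => ‖f t - h t‖) ν := (hfint.sub h_int).norm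
  have hsplit : ∀ t, ‖Φ t - h t‖ ≤ ε / 2 / (1 + ν.real univ) + ‖f t - h t‖ := fun t =>
    (norm_sub_le_norm_sub_add_norm_sub _ (f t) _).trans (by gcongr; exact hΦf t)
  calc ∫ t, ‖Φ t - h t‖ ∂ν
      ≤ ∫ t, (ε / 2 / (1 + ν.real univ) + ‖f t - h t‖) ∂ν :=
        integral_mono (hΦint.sub h_int).norm ((integrable_const _).add hfhint) hsplit
    _ = ν.real univ / (1 + ν.real univ) * (ε / 2) + ∫ t, ‖f t - h t‖ ∂ν := by
        rw [integral_add (integrable_const _) hfhint, integral_const, smul_eq_mul]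
        ring
    _ ≤ 1 * (ε / 2) + ε / 2 := by
        gcongr
        exact div_le_one_of_le₀ (by linarith) hmass.le
    _ = ε := by ring

theorem exists_contDiff_norm_le_one_sub_le_integral_inner [Fact (0 < M)] {E : Type*}
    [NormedAddCommGroup E] [InnerProductSpace ℝ E] [CompleteSpace E]
    (W : VectorMeasure (AddCircle M) E) [IsFiniteMeasure W.variation] {ε : ℝ} (hε : 0 < ε) :
    ∃ Φ : AddCircle M → E, ContDiff ℝ ∞ (fun t : ℝ => Φ t) ∧ (∀ t, ‖Φ t‖ ≤ 1) ∧
      W.variation.real univ - ε ≤ W.integral Φ (innerSL ℝ) := by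
  obtain ⟨h, h_int, hh, hWh⟩ := exists_norm_le_one_sub_le_integral_inner W (half_pos hε)
  obtain ⟨Φ, hΦ, hΦ1, hΦh⟩ :=
    exists_contDiff_norm_le_one_integral_norm_sub_le h_int hh (half_pos hε)
  have hdiff : W.integral h (innerSL ℝ) - W.integral Φ (innerSL ℝ) ≤ ε / 2 :=
    calc W.integral h (innerSL ℝ) - W.integral Φ (innerSL ℝ)
        ≤ ‖W.integral Φ (innerSL ℝ) - W.integral h (innerSL ℝ)‖ := by
          rw [norm_sub_rev]; exact le_abs_self _
      _ = ‖W.integral (fun t => Φ t - h t) (innerSL ℝ)‖ := by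
          rw [VectorMeasure.integral_fun_sub (integrable_of_continuous_coe hΦ.continuous _) h_int]
      _ ≤ ∫ t, ‖Φ t - h t‖ ∂W.variation := norm_integral_inner_le
      _ ≤ ε / 2 := hΦh
  exact ⟨Φ, hΦ, hΦ1, by linarith⟩

theorem iSup_enorm_eq_one {X E : Type*} [NormedAddCommGroup E] {Φ : X → E}
    (hle : ∀ t, ‖Φ t‖ ≤ 1) {t₀ : X} (ht₀ : ‖Φ t₀‖ = 1) : ⨆ t, ‖Φ t‖ₑ = 1 := by
  refine le_antisymm (iSup_le fun t => ?_) (le_iSup_of_le t₀ ?_)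
  · rw [← ofReal_norm]
    exact ENNReal.ofReal_le_one.2 (hle t)
  · rw [← ofReal_norm, ht₀, ENNReal.ofReal_one]

theorem exists_iSup_enorm_eq_one_eq_smul [Fact (0 < M)] {E : Type*} [NormedAddCommGroup E]
    [NormedSpace ℝ E] [Nontrivial E] {n : WithTop ℕ∞} {Φ : AddCircle M → E}
    (hΦ : ContDiff ℝ n fun t : ℝ => Φ t) (hΦ1 : ∀ t, ‖Φ t‖ ≤ 1) :
    ∃ (s : ℝ) (Ψ : AddCircle M → E), s ∈ Icc 0 1 ∧ ContDiff ℝ n (fun t : ℝ => Ψ t) ∧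
      ⨆ t, ‖Ψ t‖ₑ = 1 ∧ Φ = s • Ψ := by
  obtain ⟨t₀, -, ht₀⟩ := isCompact_univ.exists_isMaxOn univ_nonempty
    (continuous_of_continuous_coe hΦ.continuous).norm.continuousOn
  have hmax : ∀ t, ‖Φ t‖ ≤ ‖Φ t₀‖ := fun t => ht₀ (mem_univ t)
  rcases (norm_nonneg (Φ t₀)).eq_or_lt with h0 | hpos
  · obtain ⟨e, he⟩ := exists_norm_eq E zero_le_one
    have hzero : Φ = 0 := funext fun t => norm_le_zero_iff.1 ((hmax t).trans_eq h0.symm)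
    exact ⟨0, fun _ => e, by simp, contDiff_const,
      iSup_enorm_eq_one (fun _ => he.le) (t₀ := t₀) he, by simp [hzero]⟩
  · have hnorm : ∀ t, ‖(‖Φ t₀‖⁻¹ • Φ) t‖ = ‖Φ t₀‖⁻¹ * ‖Φ t‖ := fun t => by
      rw [Pi.smul_apply, norm_smul, norm_inv, norm_norm]
    refine ⟨‖Φ t₀‖, ‖Φ t₀‖⁻¹ • Φ, ⟨norm_nonneg _, hΦ1 t₀⟩, hΦ.const_smul _,
      iSup_enorm_eq_one (fun t => ?_) (t₀ := t₀) ?_, (smul_inv_smul₀ hpos.ne' Φ).symm⟩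
    · rw [hnorm]
      exact inv_mul_le_one_of_le₀ (hmax t) hpos.le
    · rw [hnorm, inv_mul_cancel₀ hpos.ne']

theorem pairing_add_pairing_eq_integral_inner {w : Fin 2 → RadonMeasure M}
    {Φ : AddCircle M → EuclideanSpace ℝ (Fin 2)} (hΦ : (euclideanMeasure w).Integrable Φ) :
    pairing (w 0) (fun t => Φ t 0) + pairing (w 1) (fun t => Φ t 1)
      = (euclideanMeasure w).integral Φ (innerSL ℝ) := by
  rw [← sum_integral_eq_integral_inner hΦ, Fin.sum_univ_two]
  rfl

theorem integral_inner_le_riTV [Fact (0 < M)] (w : Fin 2 → RadonMeasure M)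
    {Φ : AddCircle M → EuclideanSpace ℝ (Fin 2)} (hΦ : ContDiff ℝ ∞ fun t : ℝ => Φ t)
    (hsup : ⨆ t, ‖Φ t‖ₑ = 1) :
    (((euclideanMeasure w).integral Φ (innerSL ℝ) : ℝ) : EReal) ≤ riTV w := by
  rw [← pairing_add_pairing_eq_integral_inner (integrable_of_continuous_coe hΦ.continuous _)]
  exact le_iSup₂_of_le (fun i t => Φ t i) ⟨contDiff_euclidean.1 hΦ, hsup⟩ le_rfl

theorem integral_inner_le_riTV_of_norm_le_one [Fact (0 < M)] (w : Fin 2 → RadonMeasure M)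
    {Φ : AddCircle M → EuclideanSpace ℝ (Fin 2)} (hΦ : ContDiff ℝ ∞ fun t : ℝ => Φ t)
    (hΦ1 : ∀ t, ‖Φ t‖ ≤ 1) :
    (((euclideanMeasure w).integral Φ (innerSL ℝ) : ℝ) : EReal) ≤ riTV w := by
  obtain ⟨s, Ψ, ⟨hs0, hs1⟩, hΨ, hsup, rfl⟩ := exists_iSup_enorm_eq_one_eq_smul hΦ hΦ1
  have hle : (euclideanMeasure w).integral (s • Ψ) (innerSL ℝ)
      ≤ |(euclideanMeasure w).integral Ψ (innerSL ℝ)| := by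
    rw [VectorMeasure.integral_smul, smul_eq_mul]
    exact (le_abs_self _).trans <| by
      rw [abs_mul, abs_of_nonneg hs0]
      exact mul_le_of_le_one_left (abs_nonneg _) hs1
  refine (EReal.coe_le_coe hle).trans ?_
  rcases abs_choice ((euclideanMeasure w).integral Ψ (innerSL ℝ)) with h | h <;> rw [h]
  · exact integral_inner_le_riTV w hΨ hsup
  · rw [← VectorMeasure.integral_neg]
    exact integral_inner_le_riTV w hΨ.neg (by simpa using hsup)

theorem riTV_le_variation [Fact (0 < M)] (w : Fin 2 → RadonMeasure M) :
    riTV w ≤ ((euclideanMeasure w).variation.real univ : EReal) := by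
  refine iSup₂_le fun φ ⟨hφ, hφ1⟩ => EReal.coe_le_coe ?_
  let Φ : AddCircle M → EuclideanSpace ℝ (Fin 2) := fun t => WithLp.toLp 2 fun i => φ i t
  have hΦ : ContDiff ℝ ∞ fun t : ℝ => Φ t := contDiff_euclidean.2 hφ
  have hΦ1 : ∀ t, ‖Φ t‖ ≤ 1 := fun t => by
    rw [← ENNReal.ofReal_le_one, ofReal_norm, ← hφ1]
    exact le_iSup (fun t => ‖Φ t‖ₑ) t
  rw [pairing_add_pairing_eq_integral_inner (integrable_of_continuous_coe hΦ.continuous _)]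
  simpa using (le_abs_self _).trans (norm_integral_inner_le_of_norm_le hΦ1)

theorem variation_le_riTV [Fact (0 < M)] (w : Fin 2 → RadonMeasure M) :
    ((euclideanMeasure w).variation.real univ : EReal) ≤ riTV w := by
  refine EReal.ge_of_forall_gt_iff_ge.1 fun c hc => ?_
  obtain ⟨Φ, hΦ, hΦ1, hle⟩ := exists_contDiff_norm_le_one_sub_le_integral_inner
    (euclideanMeasure w) (sub_pos.2 (EReal.coe_lt_coe_iff.1 hc))
  rw [sub_sub_cancel] at hle
  exact (EReal.coe_le_coe hle).trans (integral_inner_le_riTV_of_norm_le_one w hΦ hΦ1)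

theorem riTV_eq_variation [Fact (0 < M)] (w : Fin 2 → RadonMeasure M) :
    riTV w = ((euclideanMeasure w).variation univ : EReal) := by
  rw [← ofReal_measureReal, EReal.coe_ennreal_ofReal, max_eq_left measureReal_nonneg]
  exact (riTV_le_variation w).antisymm (variation_le_riTV w)

theorem unitBall_eq_preimage [Fact (0 < M)] : unitBall M = euclideanMeasure ⁻¹' tvBall _ _ := by
  ext w
  change riTV w ≤ 1 ↔ (euclideanMeasure w).variation univ ≤ 1
  rw [riTV_eq_variation]
  exact_mod_cast Iff.rfl

theorem unitSphere_eq_preimage [Fact (0 < M)] :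
    unitSphere M = euclideanMeasure ⁻¹' tvSphere _ _ := by
  ext w
  change riTV w = 1 ↔ (euclideanMeasure w).variation univ = 1
  rw [riTV_eq_variation]
  exact_mod_cast Iff.rfl

theorem euclideanMeasure_vectorDiracComb (a : EuclideanSpace ℝ (Fin 2)) (t₀ : AddCircle M) :
    euclideanMeasure (vectorDiracComb M a t₀) = VectorMeasure.dirac t₀ a := by
  ext A hA i
  by_cases h : t₀ ∈ A
  · simp [euclideanMeasure_apply, vectorDiracComb, diracComb,
      VectorMeasure.dirac_apply_of_mem hA h]
  · simp [euclideanMeasure_apply, vectorDiracComb, diracComb,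
      VectorMeasure.dirac_apply_of_notMem h]

theorem euclideanMeasure_eq_dirac_iff {w : Fin 2 → RadonMeasure M} {t₀ : AddCircle M}
    {a : EuclideanSpace ℝ (Fin 2)} :
    euclideanMeasure w = VectorMeasure.dirac t₀ a ↔ w = vectorDiracComb M a t₀ := by
  rw [← euclideanMeasure_vectorDiracComb, euclideanMeasure.injective.eq_iff]

end RotationInvariantTV

end RITV

end

theorem mainTheorem4 (M : ℝ) (hM : 0 < M) (w : Fin 2 → RITV.RadonMeasure M) :
    (w ∈ (RITV.unitBall M).extremePoints ℝ ↔
      ∃ (t₀ : AddCircle M) (a : EuclideanSpace ℝ (Fin 2)),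
        ‖a‖ = 1 ∧ w = RITV.vectorDiracComb M a t₀) ∧
    (w ∈ (RITV.unitSphere M).extremePoints ℝ ↔
      ∃ (t₀ : AddCircle M) (a : EuclideanSpace ℝ (Fin 2)),
        ‖a‖ = 1 ∧ w = RITV.vectorDiracComb M a t₀) := by
  have : Fact (0 < M) := ⟨hM⟩
  simp only [← RITV.euclideanMeasure_eq_dirac_iff]
  constructor
  · rw [RITV.unitBall_eq_preimage, RITV.mem_extremePoints_preimage_iff,
      RITV.mem_extremePoints_tvBall_iff]
  · rw [RITV.unitSphere_eq_preimage, RITV.mem_extremePoints_preimage_iff,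
      RITV.mem_extremePoints_tvSphere_iff]
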